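/- Let $\Delta=\{\mathbf e,\mathbf n,\mathbf w,\mathbf s\}$ with $\mathbf e=(1,0)$, $\mathbf n=(0,1)$, $\mathbf w=-\mathbf e$, $\mathbf s=-\mathbf n$. Given a stochastic matrix $\omega_x=(\omega_x(d,d'))_{d,d'\in\Delta}$ for each $x\in\mathbb Z^2$, the persistent random walk in the environment $\omega$ with initial condition $\xi=(x_0,d_0)\in\mathbb Z^2\times\Delta$ is the Markov chain $(X_n,D_n)_{n\ge 0}$ on $\mathbb Z^2\times\Delta$ with law $P_\xi$ that starts at $(X_0,D_0)=\xi$ and jumps from $(x,d)$ to $(x+d',d')$ with probability $\omega_x(d,d')$, for $d'\in\Delta$. It is called recurrent for the initial condition $\xi$ if $P_\xi\{(X_n,D_n)=\xi\text{ for some }n>0\}=1$, and non-recurrent for $\xi$ if this probability is less than $1$. The walk has asymptotic velocity $v\in\mathbb R^2$ if, for every initial condition $\xi$, $\lim_{n\to\infty}X_n/n=v$ $P_\xi$-almost surely. For $d\in\Delta$ let Forward be $d$, Left be $d$ rotated by $+90^\circ$, Right be $d$ rotated by $-90^\circ$, and Backward be $-d$. Call $x=(x^1,x^2)\in\mathbb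 Z^2$ even if $x^1+x^2$ is even, and odd otherwise. Let $(\zeta_x)_{x\in\mathbb Z^2}$ be numbers in $[0,1]$ and let $\omega$ be the following environment. If $x$ is even and $d\in\{\mathbf n,\mathbf s\}$, then $\omega_x(d,\cdot)$ gives probability $\zeta_x$ to Forward, $(1-\zeta_x)/2$ to each of Left and Right, and $0$ to Backward. In all other cases (that is, $x$ even and $d\in\{\mathbf e,\mathbf w\}$, or $x$ odd and $d\in\Delta$ arbitrary), $\omega_x(d,\cdot)$ gives probability $1/2$ to each of Left and Right, and $0$ to Forward and Backward. **Proposition.** Suppose that $\zeta_x>0$ for at least one even $x\in\mathbb Z^2$. Then the walk is recurrent for the initial condition $\xi=(x_0,d_0)$ if $$x_0\text{ is even and }d_0\in\{\mathbf e,\mathbf w\},\qquad\text{or}\qquad x_0\text{ is odd and }d_0\in\{\mathbf n,\mathbf s\},$$ and it is non-recurrent for every other initial condition. Moreover, the walk has asymptotic velocity zero: for every initial condition $\xi$, $X_n/n\to 0$ $P_\xi$-almost surely. -/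

import Mathlib

open MeasureTheory ProbabilityTheory Filter Topology

namespace PersistentWalk

/-- The four lattice directions `Δ = {±e₁, ±e₂}`. -/
inductive Dir
  | east | north | west | south
  deriving DecidableEq

namespace Dir

instance : Fintype Dir where
  elems := {east, north, west, south}
  complete d := by cases d <;> decide

/-- The unit vector of `ℤ²` that a direction stands for. -/
def vec : Dir → ℤ × ℤ
  | east => (1, 0)
  | north => (0, 1)
  | west => (-1, 0)
  | south => (0, -1)

/-- The direction obtained by a counterclockwise quarter turn. -/
def left : Dir → Dir
  | east => north
  | north => west
  | west => south
  | south => east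

/-- The direction obtained by a clockwise quarter turn. -/
def right : Dir → Dir
  | east => south
  | south => west
  | west => north
  | north => east

/-- Forward: the direction itself. (Backward is the only remaining relative direction.) -/
def forward (d : Dir) : Dir := d

/-- All sets of directions are measurable. -/
instance : MeasurableSpace Dir := ⊤

instance : DiscreteMeasurableSpace Dir := ⟨fun _ => trivial⟩

end Dir

/-- States of a persistent walk: the current site and the direction of the last jump. -/
abbrev State : Type := (ℤ × ℤ) × Dir

/-- Environments: a stochastic `4 × 4` matrix, indexed by the directions, at each site. -/
abbrev Env : Type := ℤ × ℤ → Matrix.rowStochastic ℝ Dir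

/-- The law of the next direction, given the current state. -/
noncomputable def nextDir (ω : Env) (s : State) : PMF Dir :=
  PMF.ofFintype (fun d' => ENNReal.ofReal ((ω s.1 : Matrix Dir Dir ℝ) s.2 d')) (by
    rw [← ENNReal.ofReal_sum_of_nonneg
        (fun i _ => Matrix.nonneg_of_mem_rowStochastic (ω s.1).2),
      Matrix.sum_row_of_mem_rowStochastic (ω s.1).2, ENNReal.ofReal_one])

/-- One step of the chain: from `(x, d)`, choose `d'` with probability `ω_x(d, d')` and
go to `(x + d', d')`. -/
noncomputable def nextState (ω : Env) (s : State) : PMF State :=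
  (nextDir ω s).map fun d' => (s.1 + d'.vec, d')

/-- The transition kernel of the chain on `ℤ² × Δ`. -/
noncomputable def stepKernel (ω : Env) : Kernel State State where
  toFun s := (nextState ω s).toMeasure
  measurable' := measurable_of_countable _

instance (ω : Env) : IsMarkovKernel (stepKernel ω) :=
  ⟨fun s => inferInstanceAs (IsProbabilityMeasure (nextState ω s).toMeasure)⟩

/-- The transition kernel as a kernel from histories: only the last state matters. -/
noncomputable def historyKernel (ω : Env) (n : ℕ) :
    Kernel ((i : Finset.Iic n) → (fun _ : ℕ => State) i) State :=
  (stepKernel ω).comap (fun h => h ⟨n, Finset.mem_Iic.2 le_rfl⟩) (measurable_pi_apply _)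

instance (ω : Env) (n : ℕ) : IsMarkovKernel (historyKernel ω n) := by
  unfold historyKernel; infer_instance

/-- The law `P_ξ^ω`, on paths `n ↦ (X_n, D_n)`, of the persistent random walk in the environment
`ω` with initial condition `ξ`. -/
noncomputable def pathLaw (ω : Env) (ξ : State) : Measure (ℕ → State) :=
  Kernel.traj (X := fun _ : ℕ => State) (historyKernel ω) 0 (fun _ => ξ)

/-- The walk in `ω` started from `ξ` is recurrent: almost surely it comes back to `ξ`. -/
def RecurrentFrom (ω : Env) (ξ : State) : Prop :=
  pathLaw ω ξ {Z | ∃ n : ℕ, 0 < n ∧ Z n = ξ} = 1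

/-- The walk in `ω` has asymptotic velocity `v`: for every initial condition, `X_n / n → v`
almost surely. -/
def HasAsymptoticVelocity (ω : Env) (v : ℝ × ℝ) : Prop :=
  ∀ ξ : State, ∀ᵐ Z ∂(pathLaw ω ξ),
    Tendsto (fun n : ℕ => (((Z n).1.1 : ℝ) / (n : ℝ), ((Z n).1.2 : ℝ) / (n : ℝ))) atTop (𝓝 v)

/-- The even sublattice of `ℤ²`. -/
def EvenSite (x : ℤ × ℤ) : Prop := Even (x.1 + x.2)

instance : DecidablePred EvenSite := fun x => inferInstanceAs (Decidable (Even (x.1 + x.2)))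

/-- The `4 × 4` matrix with Forward probability `f d`, Left and Right probabilities
`(1 - f d) / 2`, and Backward probability `0`. -/
noncomputable def forwardMatrix (f : Dir → ℝ) : Matrix Dir Dir ℝ :=
  Matrix.of fun d d' =>
    if d' = d.forward then f d
    else if d' = d.left ∨ d' = d.right then (1 - f d) / 2
    else 0

/-- The Forward probability at the site `x` for a walker arriving with direction `d`:
`ζ_x` if `x` is even and `d` is North or South, and `0` in all other cases. -/
noncomputable def forwardProb (ζ : ℤ × ℤ → Set.Icc (0 : ℝ) 1) (x : ℤ × ℤ) (d : Dir) : ℝ :=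
  if EvenSite x ∧ (d = Dir.north ∨ d = Dir.south) then (ζ x : ℝ) else 0

theorem forwardMatrix_mem (f : Dir → ℝ) (hf : ∀ d, f d ∈ Set.Icc (0 : ℝ) 1) :
    forwardMatrix f ∈ Matrix.rowStochastic ℝ Dir := by
  rw [Matrix.mem_rowStochastic_iff_sum]
  constructor
  · intro d d'
    have h0 := (hf d).1
    have h1 := (hf d).2
    simp only [forwardMatrix, Matrix.of_apply]
    split_ifs <;> linarith
  · intro d
    have hu : (Finset.univ : Finset Dir) = {Dir.east, Dir.north, Dir.west, Dir.south} := rfl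
    cases d <;>
      simp [hu, forwardMatrix, Dir.forward, Dir.left, Dir.right] <;> ring

theorem forwardProb_mem (ζ : ℤ × ℤ → Set.Icc (0 : ℝ) 1) (x : ℤ × ℤ) (d : Dir) :
    forwardProb ζ x d ∈ Set.Icc (0 : ℝ) 1 := by
  unfold forwardProb
  split_ifs
  · exact (ζ x).2
  · simp

/-- The environment in which the walker may go Forward (with probability `ζ_x`) only when it
arrives from the North or the South at an even site `x`, and otherwise turns Left or Right with
equal probabilities. -/
noncomputable def northSouthEnv (ζ : ℤ × ℤ → Set.Icc (0 : ℝ) 1) : Env :=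
  fun x => ⟨forwardMatrix (forwardProb ζ x), forwardMatrix_mem _ (forwardProb_mem ζ x)⟩

end PersistentWalk

namespace PersistentWalk

/-! Every step flips the parity of the site, and a turn exchanges horizontal and vertical
directions. Hence turns preserve the class of `TurningState`, which is exactly the set of initial
conditions claimed recurrent, while a Forward step switches class. Forward is possible only from
outside this class, so the class is closed.

Inside it the walk turns at every step, so two steps change the two coordinates by independent
signs. At times `4 * m + 4` the return probability is at least a constant over `m + 1`
(`one_div_le_hitProb`). The expected number of returns is then infinite, and the last-visit identity
`sum_hitProb_mul_avoidProb` turns this into recurrence.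

Outside the class, pairs of turns lead with positive probability to an even site with `ζ > 0`,
entered vertically. A Forward step there enters the closed class for ever, and the starting state is
never seen again (`canAvoid_self_of_not_turningState`).

Velocity zero holds because the walk goes Forward at most once and turns symmetrically otherwise. A
weighted exponential of a coordinate grows by at most `cosh l` per step, and Chernoff with
Borel–Cantelli concludes. -/

/-! ### The path law and its Markov property. -/

instance (ω : Env) (ξ : State) : IsProbabilityMeasure (pathLaw ω ξ) := by
  unfold pathLaw; infer_instance

theorem lintegral_comp_frestrictLe_pathLaw (ω : Env) (ξ : State) (n : ℕ)
    {F : ((i : Finset.Iic n) → State) → ENNReal} (hF : Measurable F) :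
    ∫⁻ Z, F (Preorder.frestrictLe (π := fun _ => State) n Z) ∂(pathLaw ω ξ) =
      ∫⁻ h, F h ∂(Kernel.partialTraj (X := fun _ : ℕ => State) (historyKernel ω) 0 n
        (fun _ => ξ)) := by
  rw [← Kernel.traj_map_frestrictLe_apply, lintegral_map hF (by fun_prop)]
  rfl

/-- The Markov property of the path law. -/
theorem lintegral_mul_succ_pathLaw (ω : Env) (ξ : State) (n : ℕ)
    {φ : ((i : Finset.Iic n) → State) → ENNReal} (hφ : Measurable φ) (g : State → ENNReal) :
    ∫⁻ Z, φ (Preorder.frestrictLe (π := fun _ => State) n Z) * g (Z (n + 1)) ∂(pathLaw ω ξ) =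
      ∫⁻ Z, φ (Preorder.frestrictLe (π := fun _ => State) n Z) *
        ∫⁻ s, g s ∂(stepKernel ω (Z n)) ∂(pathLaw ω ξ) := by
  have hg : Measurable g := measurable_of_countable _
  have hg' : Measurable fun s => ∫⁻ t, g t ∂(stepKernel ω s) := measurable_of_countable _
  have hF : Measurable fun h : (i : Finset.Iic (n + 1)) → State =>
      φ (Preorder.frestrictLe₂ (π := fun _ => State) n.le_succ h) *
        g (h ⟨n + 1, Finset.mem_Iic.2 le_rfl⟩) :=
    (hφ.comp (by fun_prop)).mul (hg.comp (by fun_prop))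
  have hG : Measurable fun h : (i : Finset.Iic n) → State =>
      φ h * ∫⁻ t, g t ∂(stepKernel ω (h ⟨n, Finset.mem_Iic.2 le_rfl⟩)) :=
    hφ.mul (hg'.comp (measurable_pi_apply _))
  refine (lintegral_comp_frestrictLe_pathLaw ω ξ (n + 1) hF).trans
    (Eq.trans ?_ (lintegral_comp_frestrictLe_pathLaw ω ξ n hG).symm)
  rw [Kernel.partialTraj_succ_eq_comp (Nat.zero_le n), Kernel.lintegral_comp _ _ _ hF]
  refine lintegral_congr fun h => ?_
  rw [Kernel.partialTraj_succ_self, Kernel.lintegral_map _ (by fun_prop) _ hF,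
    Kernel.lintegral_id_prod (measurable_of_countable _),
    Kernel.lintegral_map _ (by fun_prop) _ (measurable_of_countable _)]
  have h1 : ∀ a : State, Preorder.frestrictLe₂ (π := fun _ => State) n.le_succ
      (IicProdIoc (X := fun _ => State) n (n + 1)
        (h, MeasurableEquiv.piSingleton (X := fun _ => State) n a)) = h := by
    intro a
    ext i : 1
    have := Finset.mem_Iic.1 i.2
    simp [IicProdIoc, this]
  have h2 : ∀ a : State, (IicProdIoc (X := fun _ => State) n (n + 1)
        (h, MeasurableEquiv.piSingleton (X := fun _ => State) n a))
        ⟨n + 1, Finset.mem_Iic.2 le_rfl⟩ = a := by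
    intro a
    simp [IicProdIoc, MeasurableEquiv.piSingleton]
  simp only [h1, h2]
  rw [lintegral_const_mul _ hg]
  rfl

theorem lintegral_zero_pathLaw (ω : Env) (ξ : State) (g : State → ENNReal) :
    ∫⁻ Z, g (Z 0) ∂(pathLaw ω ξ) = g ξ := by
  have hF : Measurable fun h : (i : Finset.Iic 0) → State =>
      g (h ⟨0, Finset.mem_Iic.2 le_rfl⟩) :=
    (measurable_of_countable g).comp (by fun_prop)
  refine (lintegral_comp_frestrictLe_pathLaw ω ξ 0 hF).trans ?_
  rw [Kernel.partialTraj_self, Kernel.id_apply, lintegral_dirac' _ hF]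

/-! ### One-step expectations as finite sums. -/

/-- The expectation of `f` after one step of the chain from the given state. -/
noncomputable def expStep (ω : Env) (f : State → ℝ) (s : State) : ℝ :=
  ∑ d : Dir, (ω s.1 : Matrix Dir Dir ℝ) s.2 d * f (s.1 + d.vec, d)

theorem expStep_mono (ω : Env) {f g : State → ℝ} (h : ∀ s, f s ≤ g s) (s : State) :
    expStep ω f s ≤ expStep ω g s :=
  Finset.sum_le_sum fun _ _ =>
    mul_le_mul_of_nonneg_left (h _) (Matrix.nonneg_of_mem_rowStochastic (ω s.1).2)

theorem expStep_const (ω : Env) (c : ℝ) (s : State) : expStep ω (fun _ => c) s = c := by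
  unfold expStep
  rw [← Finset.sum_mul, Matrix.sum_row_of_mem_rowStochastic (ω s.1).2, one_mul]

theorem expStep_nonneg (ω : Env) {f : State → ℝ} (h : ∀ s, 0 ≤ f s) (s : State) :
    0 ≤ expStep ω f s := by
  simpa [expStep_const] using expStep_mono ω h s

theorem expStep_sub (ω : Env) (f g : State → ℝ) (s : State) :
    expStep ω (fun t => f t - g t) s = expStep ω f s - expStep ω g s := by
  simp [expStep, mul_sub]

theorem expStep_sum (ω : Env) {ι : Type*} (I : Finset ι) (f : ι → State → ℝ) (s : State) :
    expStep ω (fun t => ∑ i ∈ I, f i t) s = ∑ i ∈ I, expStep ω (f i) s := by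
  simp only [expStep, Finset.mul_sum]
  exact Finset.sum_comm

theorem expStep_mul_const (ω : Env) (f : State → ℝ) (c : ℝ) (s : State) :
    expStep ω (fun t => f t * c) s = expStep ω f s * c := by
  simp only [expStep, Finset.sum_mul, mul_assoc]

theorem lintegral_stepKernel (ω : Env) {f : State → ℝ} (hf : ∀ s, 0 ≤ f s) (s : State) :
    ∫⁻ t, ENNReal.ofReal (f t) ∂(stepKernel ω s) = ENNReal.ofReal (expStep ω f s) := by
  have h : stepKernel ω s = ((nextDir ω s).map fun d => (s.1 + d.vec, d)).toMeasure := rfl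
  rw [h, ← PMF.toMeasure_map _ _ (measurable_of_countable _),
    lintegral_map (measurable_of_countable _) (measurable_of_countable _), lintegral_fintype,
    expStep, ENNReal.ofReal_sum_of_nonneg fun i _ =>
      mul_nonneg (Matrix.nonneg_of_mem_rowStochastic (ω s.1).2) (hf _)]
  refine Finset.sum_congr rfl fun d _ => ?_
  rw [PMF.toMeasure_apply_singleton _ _ (measurableSet_singleton _),
    ENNReal.ofReal_mul (Matrix.nonneg_of_mem_rowStochastic (ω s.1).2), mul_comm]
  rfl

/-! ### Avoidance probabilities and recurrence. -/

open Classical in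
/-- The probability, from `s`, of avoiding `ξ` at the times `1, …, n`. -/
noncomputable def avoidProb (ω : Env) (ξ : State) : ℕ → State → ℝ
  | 0 => fun _ => 1
  | n + 1 => expStep ω fun t => if t = ξ then 0 else avoidProb ω ξ n t

theorem avoidProb_nonneg (ω : Env) (ξ : State) (n : ℕ) (s : State) : 0 ≤ avoidProb ω ξ n s := by
  induction n generalizing s with
  | zero => exact zero_le_one
  | succ n ih =>
    refine expStep_nonneg ω (fun t => ?_) s
    split_ifs
    exacts [le_rfl, ih t]

theorem avoidProb_le_one (ω : Env) (ξ : State) (n : ℕ) (s : State) : avoidProb ω ξ n s ≤ 1 := by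
  induction n generalizing s with
  | zero => exact le_rfl
  | succ n ih =>
    refine (expStep_mono ω (g := fun _ => 1) (fun t => ?_) s).trans_eq (expStep_const ω 1 s)
    split_ifs
    exacts [zero_le_one, ih t]

theorem avoidProb_succ_le (ω : Env) (ξ : State) (n : ℕ) (s : State) :
    avoidProb ω ξ (n + 1) s ≤ avoidProb ω ξ n s := by
  induction n generalizing s with
  | zero => exact avoidProb_le_one ω ξ 1 s
  | succ n ih =>
    refine expStep_mono ω (fun t => ?_) s
    split_ifs
    exacts [le_rfl, ih t]

theorem avoidProb_antitone (ω : Env) (ξ s : State) : Antitone fun n => avoidProb ω ξ n s :=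
  antitone_nat_of_succ_le fun n => avoidProb_succ_le ω ξ n s

-- The Markov property trades one of the `k` steps still to come for one already elapsed, so the
-- induction on `n` uses its hypothesis at `k + 1`. The case `k = 0` identifies the recursive
-- `avoidProb` with a path probability.
open Classical in
theorem lintegral_avoid_mul (ω : Env) (ξ : State) (n k : ℕ) :
    ∫⁻ Z, (∏ i ∈ Finset.Icc 1 n, if Z i = ξ then (0 : ENNReal) else 1) *
      ENNReal.ofReal (avoidProb ω ξ k (Z n)) ∂(pathLaw ω ξ) =
        ENNReal.ofReal (avoidProb ω ξ (n + k) ξ) := by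
  induction n generalizing k with
  | zero =>
    simpa using lintegral_zero_pathLaw ω ξ fun s => ENNReal.ofReal (avoidProb ω ξ k s)
  | succ n ih =>
    let φ : ((i : Finset.Iic n) → State) → ENNReal := fun h =>
      ∏ i ∈ (Finset.Icc 1 n).attach,
        if h ⟨i, Finset.mem_Iic.2 (Finset.mem_Icc.1 i.2).2⟩ = ξ then 0 else 1
    have hφ : Measurable φ := measurable_of_countable _
    have hφZ : ∀ Z : ℕ → State, φ (Preorder.frestrictLe (π := fun _ => State) n Z) =
        ∏ i ∈ Finset.Icc 1 n, if Z i = ξ then 0 else 1 := fun Z =>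
      Finset.prod_attach (Finset.Icc 1 n) fun i => if Z i = ξ then (0 : ENNReal) else 1
    let f : State → ℝ := fun t => if t = ξ then 0 else avoidProb ω ξ k t
    have hf : ∀ t, 0 ≤ f t := fun t => by
      simp only [f]
      split_ifs
      exacts [le_rfl, avoidProb_nonneg ω ξ k t]
    have key := lintegral_mul_succ_pathLaw ω ξ n hφ fun t => ENNReal.ofReal (f t)
    simp only [hφZ, lintegral_stepKernel ω hf] at key
    rw [add_right_comm, add_assoc, ← ih (k + 1)]
    refine Eq.trans (lintegral_congr fun Z => ?_) key
    rw [Finset.prod_Icc_succ_top (by omega : 1 ≤ n + 1)]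
    by_cases hZ : Z (n + 1) = ξ <;> simp [f, hZ]

theorem pathLaw_avoid (ω : Env) (ξ : State) (n : ℕ) :
    pathLaw ω ξ {Z | ∀ i ∈ Finset.Icc 1 n, Z i ≠ ξ} = ENNReal.ofReal (avoidProb ω ξ n ξ) := by
  classical
  have hm : MeasurableSet {Z : ℕ → State | ∀ i ∈ Finset.Icc 1 n, Z i ≠ ξ} := by
    measurability
  have := lintegral_avoid_mul ω ξ n 0
  rw [add_zero] at this
  rw [← this, ← lintegral_indicator_one hm]
  refine lintegral_congr fun Z => ?_
  by_cases hZ : ∀ i ∈ Finset.Icc 1 n, Z i ≠ ξ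
  · rw [Set.indicator_of_mem (by exact hZ), Finset.prod_eq_one fun i hi => if_neg (hZ i hi)]
    simp [avoidProb]
  · rw [Set.indicator_of_notMem (by exact hZ)]
    push Not at hZ
    obtain ⟨i, hi, hiZ⟩ := hZ
    rw [Finset.prod_eq_zero (f := fun i => if Z i = ξ then (0 : ENNReal) else 1) hi (if_pos hiZ),
      zero_mul]

theorem pathLaw_never_return (ω : Env) (ξ : State) :
    Tendsto (fun n => ENNReal.ofReal (avoidProb ω ξ n ξ)) atTop
      (𝓝 (pathLaw ω ξ {Z | ∃ n : ℕ, 0 < n ∧ Z n = ξ}ᶜ)) := by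
  have hset : {Z : ℕ → State | ∃ n : ℕ, 0 < n ∧ Z n = ξ}ᶜ =
      ⋂ n : ℕ, {Z | ∀ i ∈ Finset.Icc 1 n, Z i ≠ ξ} := by
    ext Z
    simp only [Set.mem_compl_iff, Set.mem_ofPred_eq, Set.mem_iInter, Finset.mem_Icc]
    push Not
    exact ⟨fun h n i hi => h i hi.1, fun h n hn => h n n ⟨hn, le_rfl⟩⟩
  simp only [hset, ← pathLaw_avoid]
  refine tendsto_measure_iInter_atTop (fun n => ?_) (fun m n hmn Z hZ i hi => ?_)
    ⟨0, measure_ne_top _ _⟩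
  · exact MeasurableSet.nullMeasurableSet (by measurability)
  · exact hZ i (Finset.Icc_subset_Icc_right hmn hi)

/-- The walk is recurrent iff the probabilities of avoiding a return tend to zero. -/
theorem recurrentFrom_iff (ω : Env) (ξ : State) :
    RecurrentFrom ω ξ ↔ Tendsto (fun n => avoidProb ω ξ n ξ) atTop (𝓝 0) := by
  have hm : MeasurableSet {Z : ℕ → State | ∃ n : ℕ, 0 < n ∧ Z n = ξ} := by
    measurability
  rw [RecurrentFrom, ← prob_compl_eq_zero_iff hm]
  have h := pathLaw_never_return ω ξ
  constructor
  · intro h0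
    rw [h0] at h
    have := (ENNReal.tendsto_toReal ENNReal.zero_ne_top).comp h
    simpa [Function.comp_def, ENNReal.toReal_ofReal (avoidProb_nonneg ω ξ _ ξ)] using this
  · intro h0
    have := ENNReal.tendsto_ofReal h0
    rw [ENNReal.ofReal_zero] at this
    exact tendsto_nhds_unique h this

/-! ### Expected visits and the last-visit decomposition. -/

open Classical in
/-- The `n`-step transition probability from `s` to `ξ`. -/
noncomputable def hitProb (ω : Env) (ξ : State) (n : ℕ) : State → ℝ :=
  (expStep ω)^[n] fun t => if t = ξ then 1 else 0

theorem hitProb_succ (ω : Env) (ξ : State) (n : ℕ) :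
    hitProb ω ξ (n + 1) = expStep ω (hitProb ω ξ n) :=
  Function.iterate_succ_apply' _ _ _

theorem hitProb_nonneg (ω : Env) (ξ : State) (n : ℕ) (s : State) : 0 ≤ hitProb ω ξ n s := by
  induction n generalizing s with
  | zero => simp only [hitProb, Function.iterate_zero, id]; split_ifs <;> norm_num
  | succ n ih => rw [hitProb_succ]; exact expStep_nonneg ω ih s

open Classical in
/-- Decomposition according to the last visit to `ξ` before time `n`. -/
theorem sum_hitProb_mul_avoidProb (ω : Env) (ξ : State) (n : ℕ) (s : State) :
    ∑ k ∈ Finset.range (n + 1), hitProb ω ξ k s * avoidProb ω ξ (n - k) ξ =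
      1 - if s = ξ then 0 else avoidProb ω ξ n s := by
  induction n generalizing s with
  | zero => by_cases hs : s = ξ <;> simp [hitProb, avoidProb, hs]
  | succ n ih =>
    -- The terms with `k > 0` are the one-step expectation of the identity for `n`. The term `k = 0`
    -- is nonzero only at `s = ξ`, where it cancels `avoidProb ω ξ (n + 1) ξ`.
    rw [Finset.sum_range_succ']
    simp only [Nat.add_sub_add_right, hitProb_succ, ← expStep_mul_const, ← expStep_sum]
    rw [funext ih, expStep_sub, expStep_const]
    change 1 - avoidProb ω ξ (n + 1) s + _ = _
    by_cases hs : s = ξ <;> simp [hitProb, hs]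

/-- If the expected number of visits to `ξ` is infinite, then the walk returns to `ξ`. -/
theorem recurrentFrom_of_not_summable (ω : Env) (ξ : State)
    (h : ¬ Summable fun n => hitProb ω ξ n ξ) : RecurrentFrom ω ξ := by
  rw [recurrentFrom_iff]
  have hT := (not_summable_iff_tendsto_nat_atTop_of_nonneg
    fun n => hitProb_nonneg ω ξ n ξ).1 h
  have hT' := (hT.comp (tendsto_add_atTop_nat 1)).inv_tendsto_atTop
  refine tendsto_of_tendsto_of_tendsto_of_le_of_le' tendsto_const_nhds hT'
    (Eventually.of_forall fun n => avoidProb_nonneg ω ξ n ξ) ?_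
  filter_upwards [(hT.comp (tendsto_add_atTop_nat 1)).eventually_gt_atTop 0] with n hn
  simp only [Function.comp_apply, Pi.inv_apply] at hn ⊢
  -- Monotonicity of `avoidProb` in time bounds its value at `n` times the expected number of visits
  -- up to `n` by the last-visit sum, which equals 1 at `s = ξ`.
  rw [← one_div, le_div_iff₀ hn, mul_comm, Finset.sum_mul]
  refine (Finset.sum_le_sum fun k _ => mul_le_mul_of_nonneg_left
    (avoidProb_antitone ω ξ ξ (Nat.sub_le n k)) (hitProb_nonneg ω ξ k ξ)).trans ?_
  rw [sum_hitProb_mul_avoidProb, if_pos rfl, sub_zero]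

/-! ### The closed class of turning states. -/

theorem Dir.vec_right (d : Dir) : d.right.vec = -d.left.vec := by
  cases d <;> rfl

theorem evenSite_add_vec (x : ℤ × ℤ) (d : Dir) : EvenSite (x + d.vec) ↔ ¬ EvenSite x := by
  cases d <;> simp only [EvenSite, Dir.vec, Prod.fst_add, Prod.snd_add] <;> grind

/-- The states in the closed class in which the walker turns at every step. -/
def TurningState (s : State) : Prop :=
  (EvenSite s.1 ∧ (s.2 = Dir.east ∨ s.2 = Dir.west)) ∨
    (¬ EvenSite s.1 ∧ (s.2 = Dir.north ∨ s.2 = Dir.south))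

theorem turningState_left (x : ℤ × ℤ) (d : Dir) :
    TurningState (x + d.left.vec, d.left) ↔ TurningState (x, d) := by
  simp only [TurningState, evenSite_add_vec]
  cases d <;> simp [Dir.left]

theorem turningState_right (x : ℤ × ℤ) (d : Dir) :
    TurningState (x + d.right.vec, d.right) ↔ TurningState (x, d) := by
  simp only [TurningState, evenSite_add_vec]
  cases d <;> simp [Dir.right]

theorem turningState_forward (x : ℤ × ℤ) (d : Dir) :
    TurningState (x + d.vec, d) ↔ ¬ TurningState (x, d) := by
  simp only [TurningState, evenSite_add_vec]
  cases d <;> simp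

theorem expStep_northSouthEnv (ζ : ℤ × ℤ → Set.Icc (0 : ℝ) 1) (f : State → ℝ) (x : ℤ × ℤ)
    (d : Dir) : expStep (northSouthEnv ζ) f (x, d) =
      forwardProb ζ x d * f (x + d.vec, d) + (1 - forwardProb ζ x d) / 2 *
        (f (x + d.left.vec, d.left) + f (x + d.right.vec, d.right)) := by
  have hu : (Finset.univ : Finset Dir) = {Dir.east, Dir.north, Dir.west, Dir.south} := rfl
  cases d <;>
    simp [expStep, northSouthEnv, hu, forwardMatrix, Dir.forward, Dir.left, Dir.right] <;> ring

theorem forwardProb_of_turningState (ζ : ℤ × ℤ → Set.Icc (0 : ℝ) 1) {x : ℤ × ℤ} {d : Dir}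
    (h : TurningState (x, d)) : forwardProb ζ x d = 0 := by
  unfold forwardProb
  rw [if_neg]
  simp only [TurningState] at h
  grind

theorem expStep_of_turningState (ζ : ℤ × ℤ → Set.Icc (0 : ℝ) 1) (f : State → ℝ) {x : ℤ × ℤ}
    {d : Dir} (h : TurningState (x, d)) : expStep (northSouthEnv ζ) f (x, d) =
      (f (x + d.left.vec, d.left) + f (x + d.right.vec, d.right)) / 2 := by
  rw [expStep_northSouthEnv, forwardProb_of_turningState ζ h]
  ring

/-! ### Asymptotic velocity -/

open Classical in
/-- An exponential of the coordinate `c`, weighted so that it grows at most by the factor `cosh l`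
in each step. -/
noncomputable def expWeight (c : ℤ × ℤ →+ ℤ) (l : ℝ) (s : State) : ℝ :=
  Real.exp (l * c s.1) * if TurningState s then 1 else Real.exp |l|

theorem expWeight_pos (c : ℤ × ℤ →+ ℤ) (l : ℝ) (s : State) : 0 < expWeight c l s := by
  unfold expWeight
  split_ifs <;> positivity

theorem exp_le_expWeight (c : ℤ × ℤ →+ ℤ) (l : ℝ) (s : State) :
    Real.exp (l * c s.1) ≤ expWeight c l s := by
  unfold expWeight
  refine le_mul_of_one_le_right (Real.exp_pos _).le ?_
  split_ifs
  exacts [le_rfl, Real.one_le_exp (abs_nonneg l)]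

/-- Left and Right displacements are opposite, so a turn averages the exponential to a factor `cosh
(l * c d.left.vec)`, at most `cosh l`. A Forward step may cost a factor `exp |l|`, but it is taken
only outside the closed class and enters it, so the lost weight `exp |l|` pays for it. -/
theorem expStep_expWeight_le (ζ : ℤ × ℤ → Set.Icc (0 : ℝ) 1) {c : ℤ × ℤ →+ ℤ}
    (hc : ∀ d : Dir, |c d.vec| ≤ 1) (l : ℝ) (s : State) :
    expStep (northSouthEnv ζ) (expWeight c l) s ≤ Real.cosh l * expWeight c l s := by
  obtain ⟨x, d⟩ := s
  have habs : ∀ d : Dir, |l * c d.vec| ≤ |l| := fun d => by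
    rw [abs_mul]
    exact mul_le_of_le_one_right (abs_nonneg l) (by exact_mod_cast hc d)
  have hturn : (Real.exp (l * c (x + d.left.vec)) + Real.exp (l * c (x + d.right.vec))) / 2 ≤
      Real.exp (l * c x) * Real.cosh l := by
    have h : (Real.exp (l * c (x + d.left.vec)) + Real.exp (l * c (x + d.right.vec))) / 2 =
        Real.exp (l * c x) * Real.cosh (l * c d.left.vec) := by
      rw [Dir.vec_right, map_add, map_add, map_neg, Real.cosh_eq]
      push_cast
      rw [mul_add, mul_add, Real.exp_add, Real.exp_add, mul_neg]
      ring
    rw [h]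
    exact mul_le_mul_of_nonneg_left (Real.cosh_le_cosh.2 (habs _)) (Real.exp_pos _).le
  have hfwd : Real.exp (l * c (x + d.vec)) ≤ Real.exp (l * c x) * Real.exp |l| := by
    rw [← Real.exp_add, Real.exp_le_exp, map_add]
    push_cast
    have := (le_abs_self _).trans (habs d)
    linarith
  have hp := forwardProb_mem ζ x d
  by_cases hA : TurningState (x, d)
  · rw [expStep_of_turningState ζ _ hA]
    simp only [expWeight, turningState_left, turningState_right, hA, if_true, mul_one]
    linarith
  · have hl := (turningState_left x d).not.2 hA
    have hr := (turningState_right x d).not.2 hA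
    have hf := (turningState_forward x d).2 hA
    rw [expStep_northSouthEnv]
    simp only [expWeight, hl, hr, hf, hA, if_true, if_false, mul_one]
    have h1 : Real.exp (l * c x) * Real.exp |l| ≤
        Real.exp (l * c x) * Real.cosh l * Real.exp |l| :=
      mul_le_mul_of_nonneg_right
        (le_mul_of_one_le_right (Real.exp_pos _).le (Real.one_le_cosh l)) (Real.exp_pos _).le
    have h2 := mul_le_mul_of_nonneg_right hturn (Real.exp_pos |l|).le
    have h3 := mul_le_mul_of_nonneg_left (hfwd.trans h1) hp.1
    have h4 := mul_le_mul_of_nonneg_left h2 (sub_nonneg.2 hp.2)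
    linarith

theorem lintegral_expWeight_le (ζ : ℤ × ℤ → Set.Icc (0 : ℝ) 1) {c : ℤ × ℤ →+ ℤ}
    (hc : ∀ d : Dir, |c d.vec| ≤ 1) (l : ℝ) (ξ : State) (n : ℕ) :
    ∫⁻ Z, ENNReal.ofReal (expWeight c l (Z n)) ∂(pathLaw (northSouthEnv ζ) ξ) ≤
      ENNReal.ofReal (Real.cosh l ^ n * expWeight c l ξ) := by
  induction n with
  | zero =>
    simpa using (lintegral_zero_pathLaw (northSouthEnv ζ) ξ
      fun s => ENNReal.ofReal (expWeight c l s)).le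
  | succ n ih =>
    have h := lintegral_mul_succ_pathLaw (northSouthEnv ζ) ξ n (φ := fun _ => 1)
      measurable_const fun s => ENNReal.ofReal (expWeight c l s)
    simp only [one_mul, lintegral_stepKernel _ fun s => (expWeight_pos c l s).le] at h
    rw [h]
    calc _ ≤ ∫⁻ Z, ENNReal.ofReal (Real.cosh l) * ENNReal.ofReal (expWeight c l (Z n))
          ∂(pathLaw (northSouthEnv ζ) ξ) := lintegral_mono fun Z => by
            rw [← ENNReal.ofReal_mul (Real.cosh_pos l).le]
            exact ENNReal.ofReal_le_ofReal (expStep_expWeight_le ζ hc l (Z n))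
      _ = ENNReal.ofReal (Real.cosh l) * ∫⁻ Z, ENNReal.ofReal (expWeight c l (Z n))
          ∂(pathLaw (northSouthEnv ζ) ξ) := lintegral_const_mul' _ _ ENNReal.ofReal_ne_top
      _ ≤ _ := by
        rw [pow_succ', mul_assoc, ENNReal.ofReal_mul (Real.cosh_pos l).le]
        gcongr

theorem measurable_comp_eval (g : State → ENNReal) (n : ℕ) :
    Measurable fun Z : ℕ → State => g (Z n) :=
  (measurable_of_countable g).comp (measurable_pi_apply n)

/-- Chernoff's bound. -/
theorem pathLaw_deviation_le (ζ : ℤ × ℤ → Set.Icc (0 : ℝ) 1) {c : ℤ × ℤ →+ ℤ}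
    (hc : ∀ d : Dir, |c d.vec| ≤ 1) (l : ℝ) (ξ : State) (n : ℕ) :
    pathLaw (northSouthEnv ζ) ξ {Z | l ^ 2 * n ≤ l * c (Z n).1} ≤
      ENNReal.ofReal (expWeight c l ξ * Real.exp (-(l ^ 2 / 2)) ^ n) := by
  calc pathLaw (northSouthEnv ζ) ξ {Z | l ^ 2 * n ≤ l * c (Z n).1}
      ≤ pathLaw (northSouthEnv ζ) ξ
          {Z | ENNReal.ofReal (Real.exp (l ^ 2 * n)) ≤ ENNReal.ofReal (expWeight c l (Z n))} :=
        measure_mono fun Z hZ => ENNReal.ofReal_le_ofReal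
          ((Real.exp_le_exp.2 hZ).trans (exp_le_expWeight c l (Z n)))
    _ ≤ (∫⁻ Z, ENNReal.ofReal (expWeight c l (Z n)) ∂(pathLaw (northSouthEnv ζ) ξ)) /
          ENNReal.ofReal (Real.exp (l ^ 2 * n)) :=
        meas_ge_le_lintegral_div
          (measurable_comp_eval (fun s => ENNReal.ofReal (expWeight c l s)) n).aemeasurable
          (by simpa using Real.exp_pos _) ENNReal.ofReal_ne_top
    _ ≤ ENNReal.ofReal (Real.cosh l ^ n * expWeight c l ξ) /
          ENNReal.ofReal (Real.exp (l ^ 2 * n)) := by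
        gcongr
        exact lintegral_expWeight_le ζ hc l ξ n
    _ ≤ _ := by
        rw [← ENNReal.ofReal_div_of_pos (Real.exp_pos _)]
        refine ENNReal.ofReal_le_ofReal ?_
        -- The growth `cosh l ≤ exp (l ^ 2 / 2)` against the threshold `exp (l ^ 2)` per step leaves
        -- the decay `exp (-(l ^ 2 / 2))`.
        rw [div_le_iff₀ (Real.exp_pos _), mul_comm (l ^ 2), Real.exp_nat_mul, mul_assoc, ← mul_pow,
          ← Real.exp_add, mul_comm, show -(l ^ 2 / 2) + l ^ 2 = l ^ 2 / 2 by ring]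
        have := expWeight_pos c l ξ
        gcongr
        exact Real.cosh_le_exp_half_sq l

/-- Borel–Cantelli, the deviation bounds being geometric. The two signs of `l` give the upper and
the lower tail. -/
theorem ae_eventually_lt_mul (ζ : ℤ × ℤ → Set.Icc (0 : ℝ) 1) {c : ℤ × ℤ →+ ℤ}
    (hc : ∀ d : Dir, |c d.vec| ≤ 1) {l : ℝ} (hl : l ≠ 0) (ξ : State) :
    ∀ᵐ Z ∂(pathLaw (northSouthEnv ζ) ξ), ∀ᶠ n : ℕ in atTop, l * c (Z n).1 < l ^ 2 * n := by
  have hsum : Summable fun n : ℕ => expWeight c l ξ * Real.exp (-(l ^ 2 / 2)) ^ n := by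
    refine (summable_geometric_of_lt_one (Real.exp_pos _).le ?_).mul_left _
    rw [Real.exp_lt_one_iff]
    have := sq_pos_of_ne_zero hl
    linarith
  have hfin : ∑' n : ℕ, pathLaw (northSouthEnv ζ) ξ {Z | l ^ 2 * n ≤ l * c (Z n).1} ≠ ⊤ :=
    ne_top_of_le_ne_top hsum.tsum_ofReal_ne_top
      (ENNReal.tsum_le_tsum fun n => pathLaw_deviation_le ζ hc l ξ n)
  filter_upwards [ae_eventually_notMem hfin] with Z hZ
  filter_upwards [hZ] with n hn
  exact not_le.1 hn

theorem ae_tendsto_coordinate_div (ζ : ℤ × ℤ → Set.Icc (0 : ℝ) 1) {c : ℤ × ℤ →+ ℤ}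
    (hc : ∀ d : Dir, |c d.vec| ≤ 1) (ξ : State) :
    ∀ᵐ Z ∂(pathLaw (northSouthEnv ζ) ξ),
      Tendsto (fun n : ℕ => (c (Z n).1 : ℝ) / n) atTop (𝓝 0) := by
  have hk : ∀ k : ℕ, (0 : ℝ) < 1 / (k + 1) := fun k => Nat.one_div_pos_of_nat
  have h1 := ae_all_iff.2 fun k : ℕ => ae_eventually_lt_mul ζ hc (hk k).ne' ξ
  have h2 := ae_all_iff.2 fun k : ℕ => ae_eventually_lt_mul ζ hc (neg_ne_zero.2 (hk k).ne') ξ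
  filter_upwards [h1, h2] with Z hZ1 hZ2
  rw [Metric.tendsto_atTop']
  intro ε hε
  obtain ⟨k, hkε⟩ := exists_nat_one_div_lt hε
  obtain ⟨N, hN⟩ := eventually_atTop.1 ((hZ1 k).and (hZ2 k))
  refine ⟨N, fun n hn => ?_⟩
  obtain ⟨ha, hb⟩ := hN n hn.le
  have hn0 : (0 : ℝ) < n := by exact_mod_cast (Nat.zero_le N).trans_lt hn
  rw [sq, mul_assoc] at ha
  rw [neg_sq, sq, mul_assoc, neg_mul, ← mul_neg] at hb
  rw [mul_lt_mul_iff_right₀ (hk k)] at ha hb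
  rw [Real.dist_eq, sub_zero, abs_div, abs_of_pos hn0, div_lt_iff₀ hn0]
  exact (abs_lt.2 ⟨by linarith, ha⟩).trans (mul_lt_mul_of_pos_right hkε hn0)

theorem hasAsymptoticVelocity_northSouthEnv (ζ : ℤ × ℤ → Set.Icc (0 : ℝ) 1) :
    HasAsymptoticVelocity (northSouthEnv ζ) (0, 0) := by
  intro ξ
  filter_upwards [ae_tendsto_coordinate_div ζ (c := AddMonoidHom.fst ℤ ℤ)
      (fun d => by cases d <;> simp [Dir.vec]) ξ,
    ae_tendsto_coordinate_div ζ (c := AddMonoidHom.snd ℤ ℤ)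
      (fun d => by cases d <;> simp [Dir.vec]) ξ] with Z h1 h2
  exact h1.prodMk_nhds h2

/-! ### Recurrence -/

/-- The transition probabilities to `0` of the simple random walk on `ℤ`. -/
noncomputable def srwProb : ℕ → ℤ → ℝ
  | 0 => fun j => if j = 0 then 1 else 0
  | k + 1 => fun j => (srwProb k (j + 1) + srwProb k (j - 1)) / 2

theorem srwProb_nonneg (k : ℕ) (j : ℤ) : 0 ≤ srwProb k j := by
  induction k generalizing j with
  | zero => simp only [srwProb]; split_ifs <;> norm_num
  | succ k ih => exact div_nonneg (add_nonneg (ih _) (ih _)) zero_le_two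

/-- Pascal's rule. As only a lower bound is asked, the boundary case `i = 0` needs just the
nonnegativity of the other term. -/
theorem choose_div_le_srwProb (k i : ℕ) : (k.choose i : ℝ) / 2 ^ k ≤ srwProb k (k - 2 * i) := by
  induction k generalizing i with
  | zero =>
    cases i with
    | zero => simp [srwProb]
    | succ i => simpa using srwProb_nonneg 0 _
  | succ k ih =>
    have hi := ih i
    have key : (((k + 1 : ℕ) : ℤ) - 2 * i) - 1 = k - 2 * i := by push_cast; ring
    cases i with
    | zero =>
      have h0 := srwProb_nonneg k ((((k + 1 : ℕ) : ℤ) - 2 * (0 : ℕ)) + 1)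
      change _ ≤ (srwProb k (_ + 1) + srwProb k (_ - 1)) / 2
      rw [Nat.choose_zero_right] at hi ⊢
      rw [key, pow_succ, ← div_div]
      exact div_le_div_of_nonneg_right (hi.trans (le_add_of_nonneg_left h0)) zero_le_two
    | succ i =>
      have hi' := ih i
      have key' : (((k + 1 : ℕ) : ℤ) - 2 * (i + 1 : ℕ)) + 1 = k - 2 * i := by push_cast; ring
      change _ ≤ (srwProb k (_ + 1) + srwProb k (_ - 1)) / 2
      rw [key, key', pow_succ, ← div_div, Nat.choose_succ_succ', Nat.cast_add, add_div]
      linarith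

theorem centralBinom_succ_div_le_srwProb (m : ℕ) {j : ℤ} (hj : j = 1 ∨ j = -1) :
    ((m + 1).centralBinom : ℝ) / 4 ^ (m + 1) ≤ srwProb (2 * m + 1) j := by
  have hchoose : (m + 1).centralBinom = 2 * (2 * m + 1).choose m := by
    rw [Nat.centralBinom, show 2 * (m + 1) = 2 * m + 1 + 1 by ring, Nat.choose_succ_succ,
      Nat.choose_symm_half]
    ring
  have hpow : (4 : ℝ) ^ (m + 1) = 2 * 2 ^ (2 * m + 1) := by
    rw [show (4 : ℝ) = 2 ^ 2 by norm_num, ← pow_mul]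
    ring
  have heq : ((m + 1).centralBinom : ℝ) / 4 ^ (m + 1) =
      ((2 * m + 1).choose m : ℝ) / 2 ^ (2 * m + 1) := by
    rw [hchoose, hpow]
    push_cast
    rw [mul_div_mul_left _ _ two_ne_zero]
  rw [heq]
  rcases hj with rfl | rfl
  · have := choose_div_le_srwProb (2 * m + 1) m
    rwa [show (((2 * m + 1 : ℕ) : ℤ) - 2 * m) = 1 by push_cast; ring] at this
  · have := choose_div_le_srwProb (2 * m + 1) (m + 1)
    rwa [show (((2 * m + 1 : ℕ) : ℤ) - 2 * (m + 1 : ℕ)) = -1 by push_cast; ring,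
      Nat.choose_symm_half] at this

theorem one_div_le_sq_centralBinom_div (m : ℕ) :
    1 / (4 * ((m : ℝ) + 1)) ≤ (((m + 1).centralBinom : ℝ) / 4 ^ (m + 1)) ^ 2 := by
  induction m with
  | zero => norm_num [Nat.centralBinom]
  | succ m ih =>
    have h : ((m + 1 + 1).centralBinom : ℝ) / 4 ^ (m + 1 + 1) =
        ((m + 1).centralBinom : ℝ) / 4 ^ (m + 1) * ((2 * m + 3) / (2 * (m + 2))) := by
      have h1 : ((m + 1 + 1 : ℕ) : ℝ) * (m + 1 + 1).centralBinom =
          2 * (2 * (m + 1 : ℕ) + 1) * (m + 1).centralBinom := by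
        exact_mod_cast Nat.succ_mul_centralBinom_succ (m + 1)
      push_cast at h1
      have : (m : ℝ) + 2 ≠ 0 := by positivity
      rw [div_mul_div_comm, div_eq_div_iff (by positivity) (by positivity),
        pow_succ (4 : ℝ) (m + 1)]
      linear_combination (2 * (4 : ℝ) ^ (m + 1)) * h1
    rw [h, mul_pow]
    refine le_trans ?_ (mul_le_mul_of_nonneg_right ih (sq_nonneg _))
    push_cast
    rw [div_pow, div_mul_div_comm, div_le_div_iff₀ (by positivity) (by positivity)]
    -- The claim reduces to `4 * (m + 1) * (m + 2) ≤ (2 * m + 3) ^ 2`, whose sides differ by 1.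
    nlinarith [(Nat.cast_nonneg m : (0 : ℝ) ≤ m)]

/-- Two steps in the closed class move both coordinates like independent simple walks. -/
theorem mul_le_expStep_expStep (ζ : ℤ × ℤ → Set.Icc (0 : ℝ) 1) {f : State → ℝ} {u v : ℤ → ℝ}
    (h : ∀ s, TurningState s → u s.1.1 * v s.1.2 ≤ f s) (s : State) (hs : TurningState s) :
    (u (s.1.1 + 1) + u (s.1.1 - 1)) / 2 * ((v (s.1.2 + 1) + v (s.1.2 - 1)) / 2) ≤
      expStep (northSouthEnv ζ) (expStep (northSouthEnv ζ) f) s := by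
  obtain ⟨x, d⟩ := s
  have hl := (turningState_left x d).2 hs
  have hr := (turningState_right x d).2 hs
  rw [expStep_of_turningState ζ _ hs, expStep_of_turningState ζ _ hl,
    expStep_of_turningState ζ _ hr]
  have h1 := h _ ((turningState_left _ _).2 hl)
  have h2 := h _ ((turningState_right _ _).2 hl)
  have h3 := h _ ((turningState_left _ _).2 hr)
  have h4 := h _ ((turningState_right _ _).2 hr)
  cases d <;> simp [Dir.left, Dir.right, Dir.vec, ← sub_eq_add_neg] at h1 h2 h3 h4 ⊢ <;> linarith

theorem half_mul_le_expStep (ζ : ℤ × ℤ → Set.Icc (0 : ℝ) 1) {f : State → ℝ} (hf : ∀ s, 0 ≤ f s)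
    {x : ℤ × ℤ} {d d' : Dir} (hs : forwardProb ζ x d = 0) (hd : d' = d.left ∨ d' = d.right) :
    1 / 2 * f (x + d'.vec, d') ≤ expStep (northSouthEnv ζ) f (x, d) := by
  rw [expStep_northSouthEnv, hs]
  have h1 := hf (x + d.left.vec, d.left)
  have h2 := hf (x + d.right.vec, d.right)
  rcases hd with rfl | rfl <;> linarith

/-- The product of simple walks controls the site but not the direction. It is therefore aimed at
the diagonal neighbour of `ξ.1` from which a step `ξ.2.left` followed by a step `ξ.2` ends in `ξ`.
These last two turns have probability `1 / 4`, whatever the turning state at that site. -/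
theorem srwProb_mul_srwProb_le_hitProb (ζ : ℤ × ℤ → Set.Icc (0 : ℝ) 1) {ξ : State}
    (hξ : TurningState ξ) (k : ℕ) (s : State) (hs : TurningState s) :
    1 / 4 * srwProb k (s.1.1 - (ξ.1 - ξ.2.vec - ξ.2.left.vec).1) *
      srwProb k (s.1.2 - (ξ.1 - ξ.2.vec - ξ.2.left.vec).2) ≤
        hitProb (northSouthEnv ζ) ξ (2 * k + 2) s := by
  induction k generalizing s with
  | zero =>
    have h0 := hitProb_nonneg (northSouthEnv ζ) ξ
    by_cases hy : s.1 = ξ.1 - ξ.2.vec - ξ.2.left.vec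
    · simp only [hy, sub_self, srwProb, if_true, mul_one, mul_zero, zero_add]
      obtain ⟨x, d⟩ := s
      obtain ⟨x₀, d₀⟩ := ξ
      have hx : x + d₀.left.vec + d₀.vec = x₀ := by
        simp only at hy
        rw [hy]
        abel
      have hpar : EvenSite x₀ ↔ EvenSite x := by
        rw [← hx, evenSite_add_vec, evenSite_add_vec, not_not]
      -- Equal parity inside the class puts `d` and `d₀` on the same axis.
      have hd : d₀.left = d.left ∨ d₀.left = d.right := by
        simp only [TurningState, hpar] at hξ hs
        by_cases hE : EvenSite x <;> cases d <;> cases d₀ <;> simp_all [Dir.left, Dir.right]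
      have hd' : d₀ = d₀.left.left ∨ d₀ = d₀.left.right := by
        cases d₀ <;> simp [Dir.left, Dir.right]
      have ht : TurningState (x + d₀.left.vec, d₀.left) := by
        rcases hd with h | h <;> rw [h]
        exacts [(turningState_left _ _).2 hs, (turningState_right _ _).2 hs]
      have h1 := half_mul_le_expStep ζ (h0 1) (forwardProb_of_turningState ζ hs) hd
      have h2 := half_mul_le_expStep ζ (h0 0) (forwardProb_of_turningState ζ ht) hd'
      rw [← hitProb_succ] at h1 h2
      have h3 : hitProb (northSouthEnv ζ) (x₀, d₀) 0 (x + d₀.left.vec + d₀.vec, d₀) = 1 := by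
        simp [hitProb, hx]
      rw [h3] at h2
      norm_num at h1 h2 ⊢
      linarith
    · refine le_trans (le_of_eq ?_) (h0 _ s)
      rw [Prod.ext_iff, not_and_or] at hy
      rcases hy with hy | hy
      · rw [show srwProb 0 _ = 0 from if_neg (sub_ne_zero.2 hy), mul_zero, zero_mul]
      · rw [show srwProb 0 (s.1.2 - _) = 0 from if_neg (sub_ne_zero.2 hy), mul_zero]
  | succ k ih =>
    have h := mul_le_expStep_expStep ζ (f := hitProb (northSouthEnv ζ) ξ (2 * k + 2))
      (u := fun a => 1 / 4 * srwProb k (a - (ξ.1 - ξ.2.vec - ξ.2.left.vec).1))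
      (v := fun b => srwProb k (b - (ξ.1 - ξ.2.vec - ξ.2.left.vec).2)) ih s hs
    rw [show 2 * (k + 1) + 2 = 2 * k + 2 + 1 + 1 by ring, hitProb_succ, hitProb_succ]
    refine le_trans (le_of_eq ?_) h
    simp only [srwProb, add_sub_right_comm, sub_right_comm _ (1 : ℤ)]
    ring

theorem one_div_le_hitProb (ζ : ℤ × ℤ → Set.Icc (0 : ℝ) 1) {ξ : State} (hξ : TurningState ξ)
    (m : ℕ) : 1 / 16 * (1 / ((m : ℝ) + 1)) ≤ hitProb (northSouthEnv ζ) ξ (4 * m + 4) ξ := by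
  have h := srwProb_mul_srwProb_le_hitProb ζ hξ (2 * m + 1) ξ hξ
  -- The target is a diagonal neighbour of `ξ.1`, at offset `±1` in each coordinate, hence an odd
  -- number `2 * m + 1` of double steps.
  rw [show 2 * (2 * m + 1) + 2 = 4 * m + 4 by ring] at h
  refine le_trans ?_ h
  have h1 := centralBinom_succ_div_le_srwProb m
    (j := ξ.1.1 - (ξ.1 - ξ.2.vec - ξ.2.left.vec).1) (by
      obtain ⟨x, d⟩ := ξ; cases d <;> simp [Dir.vec, Dir.left])
  have h2 := centralBinom_succ_div_le_srwProb m
    (j := ξ.1.2 - (ξ.1 - ξ.2.vec - ξ.2.left.vec).2) (by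
      obtain ⟨x, d⟩ := ξ; cases d <;> simp [Dir.vec, Dir.left])
  have h3 := (one_div_le_sq_centralBinom_div m).trans_eq (sq _)
  have h4 := h3.trans (mul_le_mul h1 h2 (by positivity) (srwProb_nonneg _ _))
  rw [one_div, mul_inv] at h4
  rw [one_div ((m : ℝ) + 1)]
  linarith

theorem recurrentFrom_of_turningState (ζ : ℤ × ℤ → Set.Icc (0 : ℝ) 1) {ξ : State}
    (hξ : TurningState ξ) : RecurrentFrom (northSouthEnv ζ) ξ := by
  refine recurrentFrom_of_not_summable _ _ fun hsum => ?_
  have h1 := hsum.comp_injective (i := fun m : ℕ => 4 * m + 4) fun a b h => by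
    simp only at h; omega
  have h2 := Summable.of_nonneg_of_le (fun m : ℕ => by positivity)
    (fun m => one_div_le_hitProb ζ hξ m) h1
  rw [summable_mul_left_iff (by norm_num)] at h2
  refine Real.not_summable_one_div_natCast ((summable_nat_add_iff 1).1 ?_)
  simpa using h2

/-! ### Non-recurrence -/

/-- From `s`, the walk has a positive probability of never visiting `ξ` after time `0`. -/
def CanAvoid (ω : Env) (ξ s : State) : Prop :=
  ∃ c : ℝ, 0 < c ∧ ∀ n, c ≤ avoidProb ω ξ n s

theorem not_recurrentFrom_of_canAvoid {ω : Env} {ξ : State} (h : CanAvoid ω ξ ξ) :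
    ¬ RecurrentFrom ω ξ := by
  rw [recurrentFrom_iff]
  intro h0
  obtain ⟨c, hc, hle⟩ := h
  exact hc.not_ge (ge_of_tendsto' h0 hle)

theorem CanAvoid.of_step {ω : Env} {ξ s t : State} {w : ℝ} (ht : CanAvoid ω ξ t) (hne : t ≠ ξ)
    (hw : 0 < w) (hstep : ∀ f : State → ℝ, (∀ s, 0 ≤ f s) → w * f t ≤ expStep ω f s) :
    CanAvoid ω ξ s := by
  classical
  obtain ⟨c, hc, hle⟩ := ht
  -- Passing to `n + 1` makes a first step available for every `n`, including `n = 0`.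
  refine ⟨w * c, mul_pos hw hc, fun n => le_trans ?_ (avoidProb_succ_le ω ξ n s)⟩
  refine le_trans ?_ (hstep _ fun t => ?_)
  · rw [if_neg hne]
    exact mul_le_mul_of_nonneg_left (hle n) hw.le
  · split_ifs
    exacts [le_rfl, avoidProb_nonneg ω ξ n t]

/-- The class is closed and does not contain `ξ`, so avoidance is certain and the constant 1 works.
-/
theorem canAvoid_of_turningState (ζ : ℤ × ℤ → Set.Icc (0 : ℝ) 1) {ξ s : State}
    (hξ : ¬ TurningState ξ) (hs : TurningState s) : CanAvoid (northSouthEnv ζ) ξ s := by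
  refine ⟨1, one_pos, fun n => ?_⟩
  induction n generalizing s with
  | zero => exact le_rfl
  | succ n ih =>
    obtain ⟨x, d⟩ := s
    have hl := (turningState_left x d).2 hs
    have hr := (turningState_right x d).2 hs
    have hl' := ih hl
    have hr' := ih hr
    have hl₀ : (x + d.left.vec, d.left) ≠ ξ := fun h => hξ (h ▸ hl)
    have hr₀ : (x + d.right.vec, d.right) ≠ ξ := fun h => hξ (h ▸ hr)
    rw [avoidProb, expStep_of_turningState ζ _ hs, if_neg hl₀, if_neg hr₀]
    linarith

/-- A property of even sites that passes to diagonal neighbours holds at all even sites. -/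
theorem evenSite_induction {Q : ℤ × ℤ → Prop} {x : ℤ × ℤ} (hx : EvenSite x) (h0 : Q x)
    (hstep : ∀ y, EvenSite y → Q y → ∀ a b : ℤ, (a = 1 ∨ a = -1) → (b = 1 ∨ b = -1) →
      Q (y + (a, b))) {y : ℤ × ℤ} (hy : EvenSite y) : Q y := by
  have h1 : ∀ i : ℤ, EvenSite (x + (i, i)) ∧ Q (x + (i, i)) := by
    have hev : ∀ i : ℤ, EvenSite (x + (i, i)) := fun i => by
      simp only [EvenSite, Prod.fst_add, Prod.snd_add] at hx ⊢; grind
    refine fun i => ⟨hev i, ?_⟩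
    induction i using Int.induction_on with
    | zero => simpa [← Prod.zero_eq_mk] using h0
    | succ i ih => simpa [add_assoc] using hstep _ (hev _) ih 1 1 (by simp) (by simp)
    | pred i ih =>
      simpa [add_assoc, sub_eq_add_neg] using hstep _ (hev _) ih (-1) (-1) (by simp) (by simp)
  have h2 : ∀ i j : ℤ, EvenSite (x + (i, i) + (j, -j)) ∧ Q (x + (i, i) + (j, -j)) := by
    intro i j
    have hev : ∀ j : ℤ, EvenSite (x + (i, i) + (j, -j)) := fun j => by
      simp only [EvenSite, Prod.fst_add, Prod.snd_add] at hx ⊢; grind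
    refine ⟨hev j, ?_⟩
    induction j using Int.induction_on with
    | zero => simpa [← Prod.zero_eq_mk] using (h1 i).2
    | succ j ih =>
      have := hstep _ (hev _) ih 1 (-1) (by simp) (by simp)
      rwa [add_assoc, Prod.mk_add_mk (j : ℤ), ← neg_add] at this
    | pred j ih =>
      have := hstep _ (hev _) ih (-1) 1 (by simp) (by simp)
      rwa [add_assoc, Prod.mk_add_mk (-(j : ℤ)), show -(-(j : ℤ)) + 1 = -(-(j : ℤ) - 1) by ring,
        ← sub_eq_add_neg] at this
  -- Sites of equal parity differ by `p` steps along `(1, 1)` and the rest along `(1, -1)`.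
  obtain ⟨p, hp⟩ : Even ((y.1 - x.1) + (y.2 - x.2)) := by
    simp only [EvenSite] at hx hy; grind
  have hxy : y = x + (p, p) + (y.1 - x.1 - p, -(y.1 - x.1 - p)) := by
    ext
    · simp
    · simp
      omega
  rw [hxy]
  exact (h2 _ _).2

theorem canAvoid_self_of_not_turningState (ζ : ℤ × ℤ → Set.Icc (0 : ℝ) 1)
    (hζ : ∃ x : ℤ × ℤ, EvenSite x ∧ 0 < (ζ x : ℝ)) {ξ : State} (hξ : ¬ TurningState ξ) :
    CanAvoid (northSouthEnv ζ) ξ ξ := by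
  -- Under the contrary assumption no state satisfying `CanAvoid` equals `ξ`, so `CanAvoid.of_step`
  -- applies along any path without checking that the path misses `ξ`.
  by_contra hL
  have hne : ∀ t, CanAvoid (northSouthEnv ζ) ξ t → t ≠ ξ := fun t ht h => hL (h ▸ ht)
  have hturn : ∀ (x : ℤ × ℤ) (d d' : Dir), forwardProb ζ x d = 0 → (d' = d.left ∨ d' = d.right) →
      CanAvoid (northSouthEnv ζ) ξ (x + d'.vec, d') → CanAvoid (northSouthEnv ζ) ξ (x, d) :=
    fun x d d' h0 hd h => h.of_step (hne _ h) one_half_pos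
      fun f hf => half_mul_le_expStep ζ hf h0 hd
  have hvert : ∀ (x : ℤ × ℤ) (d : Dir), EvenSite x → (d = Dir.north ∨ d = Dir.south) →
      forwardProb ζ x d = ζ x := fun x d hx hd => if_pos ⟨hx, hd⟩
  have hpos : ∀ (x : ℤ × ℤ) (d : Dir), EvenSite x → (d = Dir.north ∨ d = Dir.south) →
      0 < (ζ x : ℝ) → CanAvoid (northSouthEnv ζ) ξ (x, d) := by
    intro x d hx hd hzx
    have ht : TurningState (x + d.vec, d) := by
      rw [turningState_forward]
      simp only [TurningState]
      rcases hd with rfl | rfl <;> simp [hx]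
    have h := canAvoid_of_turningState ζ hξ ht
    refine h.of_step (hne _ h) hzx fun f hf => ?_
    rw [expStep_northSouthEnv, hvert x d hx hd]
    have h2 := (ζ x).2.2
    have := mul_nonneg (div_nonneg (sub_nonneg.2 h2) zero_le_two)
      (add_nonneg (hf (x + d.left.vec, d.left)) (hf (x + d.right.vec, d.right)))
    linarith
  have hhor : ∀ (x : ℤ × ℤ) (d : Dir), (d = Dir.east ∨ d = Dir.west) → forwardProb ζ x d = 0 := by
    rintro x d (rfl | rfl) <;> simp [forwardProb]
  obtain ⟨x, hx, hzx⟩ := hζ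
  have heven : ∀ y, EvenSite y → ∀ d, (d = Dir.north ∨ d = Dir.south) →
      CanAvoid (northSouthEnv ζ) ξ (y, d) := by
    intro y hy
    refine evenSite_induction (Q := fun y => ∀ d, (d = Dir.north ∨ d = Dir.south) →
      CanAvoid (northSouthEnv ζ) ξ (y, d)) hx (fun d hd => hpos x d hx hd hzx) ?_ hy
    intro y hy hQ a b ha hb d hd
    have hab : EvenSite (y + (a, b)) := by
      simp only [EvenSite, Prod.fst_add, Prod.snd_add] at hy ⊢
      grind
    rcases (ζ (y + (a, b))).2.1.eq_or_lt with h0 | h0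
    -- Where `ζ` vanishes both turns are available: a horizontal one undoing `a`, then a vertical
    -- one undoing `b`, lead back to `y`.
    · obtain ⟨d₁, hd₁, hv₁⟩ : ∃ d₁ : Dir, (d₁ = Dir.east ∨ d₁ = Dir.west) ∧ d₁.vec = (-a, 0) := by
        rcases ha with rfl | rfl
        exacts [⟨Dir.west, by simp [Dir.vec]⟩, ⟨Dir.east, by simp [Dir.vec]⟩]
      obtain ⟨d₂, hd₂, hv₂⟩ :
          ∃ d₂ : Dir, (d₂ = Dir.north ∨ d₂ = Dir.south) ∧ d₂.vec = (0, -b) := by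
        rcases hb with rfl | rfl
        exacts [⟨Dir.south, by simp [Dir.vec]⟩, ⟨Dir.north, by simp [Dir.vec]⟩]
      refine hturn _ _ d₁ ((hvert _ _ hab hd).trans h0.symm) (by
        rcases hd with rfl | rfl <;> rcases hd₁ with rfl | rfl <;> simp [Dir.left, Dir.right])
        (hturn _ _ d₂ (hhor _ _ hd₁) (by
          rcases hd₁ with rfl | rfl <;> rcases hd₂ with rfl | rfl <;> simp [Dir.left, Dir.right])
          ?_)
      have hback : y + (a, b) + d₁.vec + d₂.vec = y := by
        rw [hv₁, hv₂]
        ext <;> simp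
      rw [hback]
      exact hQ d₂ hd₂
    · exact hpos _ _ hab hd h0
  obtain ⟨x₀, d₀⟩ := ξ
  refine hL ?_
  by_cases hE : EvenSite x₀
  · refine heven x₀ hE d₀ ?_
    cases d₀ <;> simp_all [TurningState]
  · have hd₀ : d₀ = Dir.east ∨ d₀ = Dir.west := by
      cases d₀ <;> simp_all [TurningState]
    -- One turn from an odd site entered horizontally reaches an even site vertically.
    exact hturn x₀ d₀ d₀.left (hhor _ _ hd₀) (Or.inl rfl)
      (heven _ ((evenSite_add_vec _ _).2 hE) _ (by rcases hd₀ with rfl | rfl <;> simp [Dir.left]))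

end PersistentWalk

theorem mainTheorem5 (ζ : ℤ × ℤ → Set.Icc (0 : ℝ) 1)
    (hζ : ∃ x : ℤ × ℤ, PersistentWalk.EvenSite x ∧ 0 < (ζ x : ℝ)) :
    (∀ (x₀ : ℤ × ℤ) (d₀ : PersistentWalk.Dir),
      ((PersistentWalk.EvenSite x₀ ∧
          (d₀ = PersistentWalk.Dir.east ∨ d₀ = PersistentWalk.Dir.west)) ∨
        (¬ PersistentWalk.EvenSite x₀ ∧
          (d₀ = PersistentWalk.Dir.north ∨ d₀ = PersistentWalk.Dir.south)) →
        PersistentWalk.RecurrentFrom (PersistentWalk.northSouthEnv ζ) (x₀, d₀)) ∧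
      (¬ ((PersistentWalk.EvenSite x₀ ∧
          (d₀ = PersistentWalk.Dir.east ∨ d₀ = PersistentWalk.Dir.west)) ∨
        (¬ PersistentWalk.EvenSite x₀ ∧
          (d₀ = PersistentWalk.Dir.north ∨ d₀ = PersistentWalk.Dir.south))) →
        ¬ PersistentWalk.RecurrentFrom (PersistentWalk.northSouthEnv ζ) (x₀, d₀))) ∧
    PersistentWalk.HasAsymptoticVelocity (PersistentWalk.northSouthEnv ζ) (0, 0) := by
  refine ⟨fun x₀ d₀ => ⟨fun h => ?_, fun h => ?_⟩,
    PersistentWalk.hasAsymptoticVelocity_northSouthEnv ζ⟩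
  · exact PersistentWalk.recurrentFrom_of_turningState ζ h
  · exact PersistentWalk.not_recurrentFrom_of_canAvoid
      (PersistentWalk.canAvoid_self_of_not_turningState ζ hζ h)
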